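/- Let $\mathbb{F}_q$ be a finite field, let $U=U_n(\mathbb{F}_q)$ be the group of upper triangular $n\times n$ matrices over $\mathbb{F}_q$ with ones on the diagonal, and let $\mathfrak{n}=U-1$ be the algebra of strictly upper triangular matrices. The group $U\times U$ acts on the dual space $\mathfrak{n}^*$ by $(u\lambda v)(X)=\lambda(u^{-1}Xv^{-1})$ for $u,v\in U$, $\lambda\in\mathfrak{n}^*$, $X\in\mathfrak{n}$. Fix a nontrivial homomorphism $\theta:\mathbb{F}_q^+\to\mathbb{C}^\times$. For a function $\eta:\{(i,j)\mid 1\le i<j\le n\}\to\mathbb{F}_q$ let $\lambda_\eta\in\mathfrak{n}^*$ be the functional $\lambda_\eta(X)=\sum_{i<j}\eta_{ij}X_{ij}$, let $\mathrm{supp}(\eta)=\{(i,j)\mid \eta_{ij}\neq 0\}$, and let $\chi^\eta:U\to\mathbb{C}$ be the supercharacter $$\chi^\eta(u)=\frac{|\lambda_\eta U|}{|U\lambda_\eta U|}\sum_{\mu\in U\lambda_\eta U}\theta\bigl(\mu(u-1)\bigr).$$ Suppose that $\eta$ has at most one nonzero entry in each row and in each column, that is, $\eta_{jk}\neq 0$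 implies $\eta_{jl}=0$ for all $l>j$ with $l\neq k$ and $\eta_{ik}=0$ for all $i<k$ with $i\neq j$. Then $\chi^\eta$ is the character of an irreducible complex representation of $U$ if and only if there are no $1\le i<j<k<l\le n$ with $(i,k)\in\mathrm{supp}(\eta)$ and $(j,l)\in\mathrm{supp}(\eta)$. -/

import Mathlib

noncomputable section

namespace UnitriangularSupercharacter

universe u

/-- `χ` is the character of an irreducible finite-dimensional complex representation of `G`. -/
def IsIrreducibleCharacter {G : Type u} [Group G] (χ : G → ℂ) : Prop :=
  ∃ (V : Type u) (_ : AddCommGroup V) (_ : Module ℂ V) (_ : FiniteDimensional ℂ V)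
    (ρ : Representation ℂ G V), ρ.IsIrreducible ∧ ∀ g, χ g = ρ.character g

/-- The positive roots `ε_i - ε_j`, recorded as the pairs `(i, j)` with `i < j`. -/
abbrev PosRoot (n : ℕ) : Type := {p : Fin n × Fin n // p.1 < p.2}

variable {n : ℕ} {F : Type u} [Field F]

/-- The nilpotent algebra `𝔫` of strictly upper triangular `n × n` matrices (as a vector space). -/
def strictUpper (n : ℕ) (F : Type u) [Field F] : Submodule F (Matrix (Fin n) (Fin n) F) where
  carrier := {X | ∀ i j, j ≤ i → X i j = 0}
  add_mem' hX hY i j h := by simp [hX i j h, hY i j h]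
  zero_mem' _ _ _ := rfl
  smul_mem' c X hX i j h := by simp [hX i j h]

theorem mul_diag_of_upper {A B : Matrix (Fin n) (Fin n) F}
    (hA : ∀ i j, j < i → A i j = 0) (hB : ∀ i j, j < i → B i j = 0) (i : Fin n) :
    (A * B) i i = A i i * B i i := by
  rw [Matrix.mul_apply]
  refine Finset.sum_eq_single i (fun k _ hk => ?_) (by simp)
  rcases lt_or_gt_of_ne hk with h | h
  · rw [hA i k h, zero_mul]
  · rw [hB k i h, mul_zero]

theorem mul_upper {A B : Matrix (Fin n) (Fin n) F}
    (hA : ∀ i j, j < i → A i j = 0) (hB : ∀ i j, j < i → B i j = 0)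
    (i j : Fin n) (hij : j < i) : (A * B) i j = 0 := by
  rw [Matrix.mul_apply]
  refine Finset.sum_eq_zero (fun k _ => ?_)
  rcases lt_or_ge k i with h | h
  · rw [hA i k h, zero_mul]
  · rw [hB k j (hij.trans_le h), mul_zero]

theorem inv_upper (g : GL (Fin n) F) (hg : ∀ i j, j < i → g.val i j = 0)
    (i j : Fin n) (hij : j < i) : (g⁻¹).val i j = 0 := by
  rw [Matrix.coe_units_inv]
  have : Invertible g.val := g.invertible
  exact Matrix.blockTriangular_inv_of_blockTriangular (M := g.val) (b := id)
    (fun i j h => hg i j h) hij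

/-- `U_n(F)`: the group of upper triangular matrices with ones on the diagonal. -/
def U (n : ℕ) (F : Type u) [Field F] : Subgroup (GL (Fin n) F) where
  carrier := {g | (∀ i, g.val i i = 1) ∧ ∀ i j, j < i → g.val i j = 0}
  mul_mem' {g h} hg hh := by
    refine ⟨fun i => ?_, fun i j hij => ?_⟩
    · rw [Units.val_mul, mul_diag_of_upper hg.2 hh.2, hg.1, hh.1, one_mul]
    · rw [Units.val_mul, mul_upper hg.2 hh.2 i j hij]
  one_mem' := ⟨fun i => by simp, fun i j hij => by simp [hij.ne']⟩
  inv_mem' {g} hg := by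
    refine ⟨fun i => ?_, inv_upper g hg.2⟩
    have h := mul_diag_of_upper hg.2 (inv_upper g hg.2) i
    rw [Units.mul_inv, Matrix.one_apply_eq, hg.1, one_mul] at h
    exact h.symm

/-- The element `u - 1` of `𝔫` for `u ∈ U_n(F)`. -/
def subOne (u : U n F) : strictUpper n F :=
  ⟨u.1.val - 1, fun i j h => by
    rcases h.eq_or_lt with rfl | h
    · simp [u.2.1 j]
    · simp [u.2.2 i j h, h.ne']⟩

/-- The linear map `X ↦ u X v` of `𝔫`, for `u, v ∈ U_n(F)`. -/
def biMul (u v : U n F) : strictUpper n F →ₗ[F] strictUpper n F where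
  toFun X := ⟨u.1.val * X.1 * v.1.val, by
    intro i j hij
    rw [Matrix.mul_apply]
    refine Finset.sum_eq_zero (fun k _ => ?_)
    rcases lt_or_ge j k with hk | hk
    · rw [v.2.2 k j hk, mul_zero]
    rw [Matrix.mul_apply, Finset.sum_mul]
    refine Finset.sum_eq_zero (fun l _ => ?_)
    rcases lt_or_ge l i with hl | hl
    · rw [u.2.2 i l hl, zero_mul, zero_mul]
    · rw [X.2 l k ((hk.trans hij).trans hl), mul_zero, zero_mul]⟩
  map_add' X Y := Subtype.ext (by simp [mul_add, add_mul])
  map_smul' c X := Subtype.ext (by simp)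

/-- The functional `u λ v`, given by `(u λ v)(X) = λ(u⁻¹ X v⁻¹)`. -/
def coAct (u v : U n F) (l : Module.Dual F (strictUpper n F)) :
    Module.Dual F (strictUpper n F) :=
  l ∘ₗ biMul u⁻¹ v⁻¹

/-- The right orbit `λ U_n(F)`. -/
def rightOrbit (l : Module.Dual F (strictUpper n F)) : Set (Module.Dual F (strictUpper n F)) :=
  {m | ∃ v : U n F, m = coAct 1 v l}

/-- The two-sided orbit `U_n(F) λ U_n(F)`. -/
def twoSidedOrbit (l : Module.Dual F (strictUpper n F)) :
    Set (Module.Dual F (strictUpper n F)) :=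
  {m | ∃ u v : U n F, m = coAct u v l}

/-- The functional `λ_η = ∑_α η_α λ_α`, where `λ_{(i,j)}` reads off the entry `(i, j)`. -/
def functional (η : PosRoot n → F) : Module.Dual F (strictUpper n F) where
  toFun X := ∑ p : PosRoot n, η p * X.1 p.1.1 p.1.2
  map_add' X Y := by simp [mul_add, Finset.sum_add_distrib]
  map_smul' c X := by simp [Finset.mul_sum, mul_left_comm]

/-- The supercharacter
`χ^η(u) = |λ_η U| / |U λ_η U| * ∑_{μ ∈ U λ_η U} θ(μ(u - 1))` of `U = U_n(F)`, for `F` finite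
(so that the sum is over a finite set). -/
def superChar (θ : AddChar F ℂ) (η : PosRoot n → F) (u : U n F) : ℂ :=
  ((rightOrbit (functional η)).ncard : ℂ) / ((twoSidedOrbit (functional η)).ncard : ℂ) *
    ∑ᶠ m ∈ twoSidedOrbit (functional η), θ (m (subOne u))

/-- At most one nonzero entry in each row and each column: `η_{jk} ≠ 0` implies
`η_{jl} = 0 = η_{ik}` for all `j < l ≠ k` and `j ≠ i < k`. -/
def IsMonomial (η : PosRoot n → F) : Prop :=
  ∀ (j k : Fin n) (hjk : j < k), η ⟨(j, k), hjk⟩ ≠ 0 →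
    (∀ (l : Fin n) (hjl : j < l), l ≠ k → η ⟨(j, l), hjl⟩ = 0) ∧
    (∀ (i : Fin n) (hik : i < k), i ≠ j → η ⟨(i, k), hik⟩ = 0)

end UnitriangularSupercharacter

end

/-! Put `λ = λ_η` and `B(X, Y) = λ(XY)`. Since `u = 1 + (u - 1)`, the left and right orbits of `λ`
are the translates by `λ` of the ranges of `B` and of its flip, which have equal size
(`ncard_rightOrbit`). The supercharacter is the trace of a monomial representation on functions on
the left orbit (`superChar_eq_sum_orbit`, `character_orbitRep`), and orthogonality on `𝔫` gives it
norm `|λU|² / |UλU|`. So it is irreducible iff `|UλU| = |Uλ||λU|`, i.e. iff the two ranges meet only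
in `0` (`isIrreducibleCharacter_superChar_iff`). A common element that is nonzero at `E_{jk}` forces
`η_{ik} ≠ 0` for some `i < j` and `η_{jl} ≠ 0` for some `l > k`. Conversely, for monomial `η`, such
a crossing puts the coordinate `X ↦ X_{jk}` in both ranges. -/

noncomputable section

/-! ### Irreducibility from scalar endomorphisms -/

namespace Representation

open scoped MonoidAlgebra

/-- Over a field in which the order of the group is invertible, a representation whose only
endomorphisms are the scalars is irreducible. -/
theorem isIrreducible_of_finrank_intertwiningMap {k G V : Type*} [Field k] [Group G] [Finite G]
    [AddCommGroup V] [Module k V] [NeZero (Nat.card G : k)]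
    (ρ : Representation k G V) (h : Module.finrank k (IntertwiningMap ρ ρ) = 1) :
    ρ.IsIrreducible := by
  rw [irreducible_iff_isSimpleModule_asModule]
  have e := IntertwiningMap.equivAlgEnd (ρ := ρ)
  have h' : Module.finrank k (Module.End k[G] ρ.asModule) = 1 := by
    rw [← e.toLinearEquiv.finrank_eq, h]
  have hne : Nontrivial (Module.End k[G] ρ.asModule) :=
    Module.nontrivial_of_finrank_pos (R := k) (by omega)
  have hone : (1 : Module.End k[G] ρ.asModule) ≠ 0 := one_ne_zero
  rw [isSimpleModule_iff]
  have hnt : Nontrivial ρ.asModule := by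
    by_contra hc
    rw [not_nontrivial_iff_subsingleton] at hc
    exact hone (LinearMap.ext fun x => Subsingleton.elim _ _)
  refine { exists_pair_ne := ⟨⊥, ⊤, bot_ne_top⟩, eq_bot_or_eq_top := fun p => ?_ }
  -- Maschke: `p` has an equivariant projection. It must be a scalar `c`, so `p` is `⊥` or `⊤`
  -- according to whether `c = 0`.
  obtain ⟨f, hf⟩ := MonoidAlgebra.exists_leftInverse_of_injective p.subtype p.ker_subtype
  obtain ⟨c, hc⟩ := (finrank_eq_one_iff_of_nonzero' _ hone).mp h' (p.subtype ∘ₗ f)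
  have key : ∀ x, (f x : ρ.asModule) = c • x := fun x => (LinearMap.congr_fun hc x).symm
  by_cases hc0 : c = 0
  · left
    rw [Submodule.eq_bot_iff]
    intro x hx
    have := key x
    rw [hc0, zero_smul] at this
    rwa [show f x = ⟨x, hx⟩ from LinearMap.congr_fun hf ⟨x, hx⟩] at this
  · right
    rw [Submodule.eq_top_iff']
    intro x
    have hx : c • x ∈ p := by rw [← key]; exact (f x).2
    have := p.smul_mem (algebraMap k k[G] c⁻¹) hx
    rwa [algebraMap_smul, smul_smul, inv_mul_cancel₀ hc0, one_smul] at this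

end Representation

/-! ### Counting in finite orbits -/

namespace MulAction

/-- Averaging a function over a finite group acting is averaging over the orbit. -/
theorem card_orbit_mul_sum_smul {G X R : Type*} [Group G] [Fintype G] [MulAction G X]
    [CommSemiring R] (x : X) (f : X → R) :
    ((orbit G x).ncard : R) * ∑ g : G, f (g • x) =
      (Fintype.card G : R) * ∑ᶠ y ∈ orbit G x, f y := by
  classical
  have : Finite (orbit G x) := Set.finite_range _
  have : Fintype (orbit G x) := Fintype.ofFinite _
  have : Fintype (stabilizer G x) := Fintype.ofFinite _
  let e := orbitProdStabilizerEquivGroup G x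
  have he : ∀ p, e p • x = p.1 := fun p => by
    have : ∀ g, ((e.symm g).1 : X) = g • x := fun g => rfl
    rw [← this, e.symm_apply_apply]
  rw [← Equiv.sum_comp e, Fintype.sum_prod_type]
  simp only [he, Finset.sum_const, Finset.card_univ, nsmul_eq_mul]
  rw [← Finset.mul_sum, ← Fintype.card_congr e, Fintype.card_prod, ← finsum_set_coe_eq_finsum_mem,
    finsum_eq_sum_of_fintype, ← Nat.card_coe_set_eq, Nat.card_eq_fintype_card]
  push_cast
  rw [mul_assoc]

/-- The size of an orbit of `G × H` is the product of the sizes of the orbits of the factors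
exactly when these meet in a single point. -/
theorem ncard_orbit_prod_eq_iff {G H X : Type*} [Group G] [Group H] [Finite G] [Finite H]
    [MulAction (G × H) X] (x : X) :
    (orbit (G × H) x).ncard = (Set.range fun g : G => ((g, 1) : G × H) • x).ncard *
        (Set.range fun h : H => ((1, h) : G × H) • x).ncard ↔
      ∀ (g : G) (h : H), ((g, 1) : G × H) • x = ((1, h) : G × H) • x →
        ((g, 1) : G × H) • x = x := by
  let S := stabilizer (G × H) x
  let A := S.comap (MonoidHom.inl G H)
  let B := S.comap (MonoidHom.inr G H)
  have hA : A.index = (Set.range fun g : G => ((g, 1) : G × H) • x).ncard :=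
    letI := MulAction.compHom X (MonoidHom.inl G H)
    index_stabilizer G x
  have hB : B.index = (Set.range fun h : H => ((1, h) : G × H) • x).ncard :=
    letI := MulAction.compHom X (MonoidHom.inr G H)
    index_stabilizer H x
  have split : ∀ (g : G) (h : H), ((g, h) : G × H) • x = ((1, h) : G × H) • ((g, 1) : G × H) • x :=
    fun g h => by simp [smul_smul]
  have hle : A.prod B ≤ S := by
    rintro ⟨g, h⟩ ⟨hg, hh⟩
    have hg : ((g, 1) : G × H) • x = x := hg
    have hh : ((1, h) : G × H) • x = x := hh
    change ((g, h) : G × H) • x = x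
    rw [split, hg, hh]
  -- All three sizes are indices, and `A × B ≤ S`, so equality of sizes amounts to `S = A × B`.
  rw [← hA, ← hB, ← Subgroup.index_prod, ← index_stabilizer]
  constructor
  · intro heq g h hgh
    have h1 := Subgroup.relIndex_mul_index hle
    rw [← heq] at h1
    have h2 : (A.prod B).relIndex S = 1 :=
      Nat.eq_of_mul_eq_mul_right (Nat.pos_of_ne_zero S.index_ne_zero_of_finite) (by
        rw [one_mul]; exact h1)
    have h3 : ((g, h⁻¹) : G × H) ∈ S := by
      change ((g, h⁻¹) : G × H) • x = x
      rw [split, hgh, smul_smul, Prod.mk_mul_mk, one_mul, inv_mul_cancel]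
      exact one_smul (G × H) x
    exact (Subgroup.relIndex_eq_one.mp h2 h3).1
  · intro H'
    have hge : S ≤ A.prod B := by
      rintro ⟨g, h⟩ hs
      have hs : ((g, h) : G × H) • x = x := hs
      have h1 : ((g, 1) : G × H) • x = x := by
        refine H' g h⁻¹ ?_
        conv_rhs => rw [← hs, smul_smul]
        simp
      refine ⟨h1, ?_⟩
      change ((1, h) : G × H) • x = x
      rw [split, h1] at hs
      exact hs
    rw [le_antisymm hle hge]

end MulAction

end

noncomputable section

namespace UnitriangularSupercharacter

open Module

universe u

variable {n : ℕ} {F : Type u} [Field F]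

/-! ### The two-sided action on functionals -/

section Action

@[simp]
theorem coAct_apply (u v : U n F) (l : Dual F (strictUpper n F)) (X : strictUpper n F) :
    coAct u v l X = l (biMul u⁻¹ v⁻¹ X) := rfl

@[simp]
theorem coe_biMul (u v : U n F) (X : strictUpper n F) :
    (biMul u v X).1 = u.1.val * X.1 * v.1.val := rfl

@[simp]
theorem coe_subOne (u : U n F) : (subOne u).1 = u.1.val - 1 := rfl

theorem biMul_biMul (u v u' v' : U n F) (X : strictUpper n F) :
    biMul u v (biMul u' v' X) = biMul (u * u') (v' * v) X :=
  Subtype.ext (by simp [mul_assoc])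

@[simp]
theorem biMul_one_one (X : strictUpper n F) : biMul 1 1 X = X :=
  Subtype.ext (by simp)

/-- This cocycle identity is what makes `orbitRep` multiplicative. -/
theorem subOne_mul (u v : U n F) : subOne (u * v) = biMul u 1 (subOne v) + subOne u :=
  Subtype.ext (by simp [mul_sub])

theorem subOne_inv (u : U n F) : subOne u⁻¹ = -biMul u⁻¹ 1 (subOne u) := by
  have h := subOne_mul u⁻¹ u
  have h1 : subOne (1 : U n F) = 0 := Subtype.ext (by simp)
  rw [inv_mul_cancel, h1] at h
  exact eq_neg_of_add_eq_zero_right h.symm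

/-- The action of `U × U` on functionals, with the right action turned into a left one. -/
instance biAction : MulAction (U n F × U n F) (Dual F (strictUpper n F)) where
  smul p l := coAct p.1 p.2⁻¹ l
  one_smul l := LinearMap.ext fun X => by
    change coAct 1 1⁻¹ l X = l X
    simp
  mul_smul p q l := LinearMap.ext fun X => by
    change coAct (p * q).1 (p * q).2⁻¹ l X = coAct p.1 p.2⁻¹ (coAct q.1 q.2⁻¹ l) X
    simp [biMul_biMul]

/-- The left action of `U` on functionals. -/
instance leftAction : MulAction (U n F) (Dual F (strictUpper n F)) :=
  MulAction.compHom _ (MonoidHom.inl (U n F) (U n F))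

theorem prod_smul_apply (p : U n F × U n F) (l : Dual F (strictUpper n F))
    (X : strictUpper n F) : (p • l) X = l (biMul p.1⁻¹ p.2 X) := by
  change coAct p.1 p.2⁻¹ l X = _
  simp

theorem smul_apply (g : U n F) (l : Dual F (strictUpper n F)) (X : strictUpper n F) :
    (g • l) X = l (biMul g⁻¹ 1 X) :=
  prod_smul_apply (g, 1) l X

theorem twoSidedOrbit_eq (l : Dual F (strictUpper n F)) :
    twoSidedOrbit l = MulAction.orbit (U n F × U n F) l := by
  ext m
  constructor
  · rintro ⟨u, v, rfl⟩
    exact ⟨(u, v⁻¹), LinearMap.ext fun X => by simp [prod_smul_apply]⟩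
  · rintro ⟨p, rfl⟩
    exact ⟨p.1, p.2⁻¹, rfl⟩

end Action

/-! ### The bijection between `U` and `𝔫` -/

section Equiv

/-- The element `1 + X` of `U_n(F)`. -/
def oneAdd (X : strictUpper n F) : U n F :=
  ⟨Matrix.GeneralLinearGroup.mkOfDetNeZero (1 + X.1) (by
    rw [Matrix.det_of_isUpperTriangular]
    · simp [fun i => X.2 i i le_rfl]
    · intro i j hij
      have hij : j < i := hij
      simp [X.2 i j hij.le, hij.ne']), by
    refine ⟨fun i => ?_, fun i j hij => ?_⟩
    · simp [Matrix.GeneralLinearGroup.mkOfDetNeZero, X.2 i i le_rfl]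
    · simp [Matrix.GeneralLinearGroup.mkOfDetNeZero, X.2 i j hij.le, hij.ne']⟩

@[simp]
theorem coe_oneAdd (X : strictUpper n F) : (oneAdd X).1.val = 1 + X.1 := rfl

/-- `u ↦ u - 1` is a bijection from `U_n(F)` to `𝔫`. -/
def subOneEquiv : U n F ≃ strictUpper n F where
  toFun := subOne
  invFun := oneAdd
  left_inv u := Subtype.ext (Units.ext (by simp))
  right_inv X := Subtype.ext (by simp)

@[simp]
theorem subOneEquiv_apply (u : U n F) : subOneEquiv u = subOne u := rfl

@[simp]
theorem subOne_oneAdd (X : strictUpper n F) : subOne (oneAdd X) = X :=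
  subOneEquiv.right_inv X

end Equiv

/-! ### One-sided orbits as affine subspaces -/

section Form

/-- The product of two strictly upper triangular matrices. -/
def mulUpper (X Y : strictUpper n F) : strictUpper n F :=
  ⟨X.1 * Y.1, fun i j hij => by
    rw [Matrix.mul_apply]
    refine Finset.sum_eq_zero fun k _ => ?_
    rcases le_or_gt k i with h | h
    · rw [X.2 i k h, zero_mul]
    · rw [Y.2 k j (hij.trans h.le), mul_zero]⟩

@[simp]
theorem coe_mulUpper (X Y : strictUpper n F) : (mulUpper X Y).1 = X.1 * Y.1 := rfl

/-- The bilinear form `(X, Y) ↦ l (X Y)` on `𝔫`. -/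
def form (l : Dual F (strictUpper n F)) : strictUpper n F →ₗ[F] Dual F (strictUpper n F) :=
  LinearMap.mk₂ F (fun X Y => l (mulUpper X Y))
    (fun X X' Y => by rw [← map_add]; congr 1; exact Subtype.ext (by simp [add_mul]))
    (fun c X Y => by rw [← map_smul]; congr 1; exact Subtype.ext (by simp))
    (fun X Y Y' => by rw [← map_add]; congr 1; exact Subtype.ext (by simp [mul_add]))
    (fun c X Y => by rw [← map_smul]; congr 1; exact Subtype.ext (by simp))

@[simp]
theorem form_apply (l : Dual F (strictUpper n F)) (X Y : strictUpper n F) :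
    form l X Y = l (mulUpper X Y) := rfl

theorem biMul_left (u : U n F) (X : strictUpper n F) :
    biMul u 1 X = X + mulUpper (subOne u) X :=
  Subtype.ext (by simp [sub_mul])

theorem biMul_right (v : U n F) (X : strictUpper n F) :
    biMul 1 v X = X + mulUpper X (subOne v) :=
  Subtype.ext (by simp [mul_sub])

theorem smul_eq_add_form (g : U n F) (l : Dual F (strictUpper n F)) :
    g • l = l + form l (subOne g⁻¹) :=
  LinearMap.ext fun X => by simp [smul_apply, biMul_left]

theorem prod_one_smul_eq_add_form (v : U n F) (l : Dual F (strictUpper n F)) :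
    ((1, v) : U n F × U n F) • l = l + (form l).flip (subOne v) :=
  LinearMap.ext fun X => by simp [prod_smul_apply, biMul_right]

theorem orbit_eq_range_form (l : Dual F (strictUpper n F)) :
    MulAction.orbit (U n F) l = (fun m => l + m) '' (LinearMap.range (form l) : Set _) := by
  ext m
  constructor
  · rintro ⟨g, rfl⟩
    exact ⟨_, ⟨subOne g⁻¹, rfl⟩, (smul_eq_add_form g l).symm⟩
  · rintro ⟨_, ⟨X, rfl⟩, rfl⟩
    exact ⟨(oneAdd X)⁻¹, by simp [smul_eq_add_form]⟩

theorem rightOrbit_eq_range_form (l : Dual F (strictUpper n F)) :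
    rightOrbit l = (fun m => l + m) '' (LinearMap.range (form l).flip : Set _) := by
  ext m
  constructor
  · rintro ⟨v, rfl⟩
    refine ⟨_, ⟨subOne v⁻¹, rfl⟩, ?_⟩
    exact (prod_one_smul_eq_add_form v⁻¹ l).symm.trans
      (LinearMap.ext fun X => by simp [prod_smul_apply])
  · rintro ⟨_, ⟨X, rfl⟩, rfl⟩
    refine ⟨(oneAdd X)⁻¹, Eq.trans (b := ((1, oneAdd X) : U n F × U n F) • l) ?_
      (LinearMap.ext fun Y => by simp [prod_smul_apply])⟩
    simp [prod_one_smul_eq_add_form]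

/-- Row rank equals column rank: after identifying `V` with its bidual, the flip is the dual map. -/
theorem finrank_range_flip {K V : Type*} [Field K] [AddCommGroup V] [Module K V]
    [FiniteDimensional K V] (B : V →ₗ[K] Dual K V) :
    finrank K (LinearMap.range B.flip) = finrank K (LinearMap.range B) := by
  rw [← LinearMap.finrank_range_dualMap_eq_finrank_range B]
  have : B.flip = B.dualMap ∘ₗ (evalEquiv K V).toLinearMap := by
    ext; simp
  rw [this, LinearMap.range_comp_of_range_eq_top _ (LinearEquiv.range _)]

theorem ncard_rightOrbit [Finite F] (l : Dual F (strictUpper n F)) :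
    (rightOrbit l).ncard = (MulAction.orbit (U n F) l).ncard := by
  rw [rightOrbit_eq_range_form, orbit_eq_range_form,
    Set.ncard_image_of_injective _ (add_right_injective l),
    Set.ncard_image_of_injective _ (add_right_injective l)]
  change Nat.card (LinearMap.range (form l).flip) = Nat.card (LinearMap.range (form l))
  rw [Module.natCard_eq_pow_finrank (K := F) (V := LinearMap.range (form l).flip),
    Module.natCard_eq_pow_finrank (K := F) (V := LinearMap.range (form l)), finrank_range_flip]

end Form

/-! ### Orbit sizes and the norm of a supercharacter -/

instance [Finite F] : Finite (Dual F (strictUpper n F)) := Module.finite_of_finite F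

instance [Finite F] : Finite (U n F) := Finite.of_equiv _ subOneEquiv.symm

theorem card_eq [Finite F] : Nat.card (U n F) = Nat.card (strictUpper n F) :=
  Nat.card_congr subOneEquiv

/-- `|UlU| = |Ul||lU|` exactly when the left and the right orbit of `l` meet in `l` only. -/
theorem ncard_twoSidedOrbit_eq_iff [Finite F] (l : Dual F (strictUpper n F)) :
    (twoSidedOrbit l).ncard = (MulAction.orbit (U n F) l).ncard * (rightOrbit l).ncard ↔
      ∀ X Y : strictUpper n F, form l X = (form l).flip Y → form l X = 0 := by
  have hR : rightOrbit l = Set.range fun v : U n F => ((1, v) : U n F × U n F) • l := by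
    ext m
    constructor
    · rintro ⟨v, rfl⟩
      exact ⟨v⁻¹, LinearMap.ext fun X => by simp [prod_smul_apply]⟩
    · rintro ⟨v, rfl⟩
      exact ⟨v⁻¹, LinearMap.ext fun X => by simp [prod_smul_apply]⟩
  rw [twoSidedOrbit_eq, hR]
  refine (MulAction.ncard_orbit_prod_eq_iff l).trans ⟨fun H X Y h => ?_, fun H g h hgh => ?_⟩
  · have := H (oneAdd X)⁻¹ (oneAdd Y)
    rw [prod_one_smul_eq_add_form, show (((oneAdd X)⁻¹, 1) : U n F × U n F) • l =
      (oneAdd X)⁻¹ • l from rfl, smul_eq_add_form] at this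
    simpa [h] using this
  · rw [show ((g, 1) : U n F × U n F) • l = g • l from rfl] at hgh ⊢
    rw [prod_one_smul_eq_add_form, smul_eq_add_form, add_right_inj] at hgh
    rw [smul_eq_add_form, H _ _ hgh, add_zero]

/-- A nonzero `l` is onto `F`, so `θ ∘ l` is a nontrivial additive character and sums to zero. -/
theorem sum_addChar_dual [Finite F] {θ : AddChar F ℂ} (hθ : θ ≠ 1) {V : Type*} [AddCommGroup V]
    [Module F V] [Fintype V] (l : Dual F V) [Decidable (l = 0)] :
    ∑ X : V, θ (l X) = if l = 0 then (Nat.card V : ℂ) else 0 := by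
  classical
  have h := AddChar.sum_eq_ite (θ.compAddMonoidHom l.toAddMonoidHom)
  have hiff : θ.compAddMonoidHom l.toAddMonoidHom = 0 ↔ l = 0 := by
    constructor
    · intro h0
      by_contra hl
      refine hθ (DFunLike.ext _ _ fun c => ?_)
      obtain ⟨X, rfl⟩ := LinearMap.surjective hl c
      exact DFunLike.congr_fun h0 X
    · rintro rfl
      exact DFunLike.ext _ _ fun X => by simp
  simp only [hiff, ← Nat.card_eq_fintype_card] at h
  exact h

/-- The substitution `m ↦ u • m` permutes the two-sided orbit and turns `m(u⁻¹ - 1)` into `-m(u -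
1)`; this plays the role of complex conjugation in the norm. -/
theorem superChar_inv [Finite F] (θ : AddChar F ℂ) (η : PosRoot n → F) (u : U n F) :
    superChar θ η u⁻¹ = ((rightOrbit (functional η)).ncard : ℂ) /
      ((twoSidedOrbit (functional η)).ncard : ℂ) *
        ∑ᶠ m ∈ twoSidedOrbit (functional η), θ (-m (subOne u)) := by
  rw [superChar]
  congr 1
  refine finsum_mem_eq_of_bijOn (fun m => u • m) ?_ fun m _ => ?_
  · rw [twoSidedOrbit_eq]
    refine ⟨fun m hm => ?_, (MulAction.injective u).injOn, fun m hm => ?_⟩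
    · exact MulAction.mem_orbit_of_mem_orbit ((u, 1) : U n F × U n F) hm
    · exact ⟨u⁻¹ • m, MulAction.mem_orbit_of_mem_orbit ((u⁻¹, 1) : U n F × U n F) hm,
        smul_inv_smul u m⟩
  · rw [smul_apply, subOne_inv, map_neg]

/-- The norm of a supercharacter. -/
theorem sum_superChar_mul_superChar_inv [Finite F] [Fintype (U n F)] {θ : AddChar F ℂ}
    (hθ : θ ≠ 1) (η : PosRoot n → F) :
    (Nat.card (U n F) : ℂ)⁻¹ * ∑ u : U n F, superChar θ η u * superChar θ η u⁻¹ =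
      ((rightOrbit (functional η)).ncard : ℂ) ^ 2 / (twoSidedOrbit (functional η)).ncard := by
  classical
  have : Fintype (Dual F (strictUpper n F)) := Fintype.ofFinite _
  have : Fintype (strictUpper n F) := Fintype.ofFinite _
  set l := functional η with hl
  have hO : (twoSidedOrbit l).ncard ≠ 0 :=
    Set.ncard_ne_zero_of_mem (a := l) ⟨1, 1, LinearMap.ext fun X => by simp⟩
  have hU : (Nat.card (U n F) : ℂ) ≠ 0 := Nat.cast_ne_zero.mpr Nat.card_pos.ne'
  set O := twoSidedOrbit l with hOdef
  have hO' : (O.ncard : ℂ) ≠ 0 := Nat.cast_ne_zero.mpr hO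
  have orth : ∀ m m' : Dual F (strictUpper n F),
      ∑ u : U n F, θ (m (subOne u)) * θ (-m' (subOne u)) =
        if m = m' then (Nat.card (U n F) : ℂ) else 0 := fun m m' => by
    have h := sum_addChar_dual hθ (m - m')
    rw [← Equiv.sum_comp subOneEquiv] at h
    simp only [sub_eq_zero, ← card_eq] at h
    rw [← h]
    exact Finset.sum_congr rfl fun u _ => by
      rw [← AddChar.map_add_eq_mul, ← sub_eq_add_neg]; rfl
  simp only [superChar_inv]
  simp only [superChar, ← hl, ← hOdef, finsum_mem_eq_toFinset_sum]
  have : ∑ u : U n F, (∑ m ∈ O.toFinset, θ (m (subOne u))) *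
      (∑ m ∈ O.toFinset, θ (-m (subOne u))) = O.ncard * Nat.card (U n F) := by
    simp only [Finset.sum_mul_sum]
    rw [Finset.sum_comm]
    simp_rw [Finset.sum_comm (s := Finset.univ), orth]
    rw [Finset.sum_congr rfl fun m hm => by rw [Finset.sum_ite_eq, if_pos hm], Finset.sum_const,
      nsmul_eq_mul, Set.ncard_eq_toFinset_card']
  rw [Finset.sum_congr rfl fun u _ => mul_mul_mul_comm _ _ _ _, ← Finset.mul_sum, this]
  field_simp

/-! ### The supercharacter as a monomial character -/

/-- The values of a supercharacter as a sum over the left orbit. -/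
theorem superChar_eq_sum_orbit [Finite F] {θ : AddChar F ℂ} (hθ : θ ≠ 1) (η : PosRoot n → F)
    (g : U n F) [Fintype (MulAction.orbit (U n F) (functional η))]
    [DecidableEq (Dual F (strictUpper n F))] :
    superChar θ η g = ∑ m : MulAction.orbit (U n F) (functional η),
      if g⁻¹ • m.1 = m.1 then θ (m.1 (subOne g)) else 0 := by
  have : Fintype (strictUpper n F) := Fintype.ofFinite _
  have : Fintype (U n F) := Fintype.ofFinite _
  rw [superChar, ncard_rightOrbit]
  generalize functional η = l at *
  have hO : ((twoSidedOrbit l).ncard : ℂ) ≠ 0 := Nat.cast_ne_zero.mpr <|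
    Set.ncard_ne_zero_of_mem (a := l) ⟨1, 1, LinearMap.ext fun X => by simp⟩
  have hU : (Fintype.card (U n F) : ℂ) ≠ 0 := Nat.cast_ne_zero.mpr Fintype.card_ne_zero
  -- Summing over the right factor leaves a full character sum of `Y ↦ m((g - 1)Y)`, which vanishes
  -- unless `g⁻¹` fixes `m`.
  have inner : ∀ m : Dual F (strictUpper n F),
      ∑ v : U n F, θ ((((1, v) : U n F × U n F) • m) (subOne g)) =
        Fintype.card (U n F) * if g⁻¹ • m = m then θ (m (subOne g)) else 0 := fun m => by
    have h := sum_addChar_dual hθ (form m (subOne g))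
    rw [← Equiv.sum_comp subOneEquiv, ← card_eq, Nat.card_eq_fintype_card] at h
    have h1 : g⁻¹ • m = m ↔ form m (subOne g) = 0 := by simp [smul_eq_add_form]
    simp only [prod_one_smul_eq_add_form, LinearMap.add_apply, AddChar.map_add_eq_mul, h1,
      LinearMap.flip_apply, ← Finset.mul_sum]
    simp only [subOneEquiv_apply] at h
    rw [h]
    split_ifs <;> ring
  have h2 := MulAction.card_orbit_mul_sum_smul (G := U n F × U n F) l fun m => θ (m (subOne g))
  have h1 := MulAction.card_orbit_mul_sum_smul (G := U n F) l fun m =>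
    if g⁻¹ • m = m then θ (m (subOne g)) else 0
  have h3 : ∑ p : U n F × U n F, θ ((p • l) (subOne g)) = Fintype.card (U n F) *
      ∑ u : U n F, if g⁻¹ • u • l = u • l then θ ((u • l) (subOne g)) else 0 := by
    rw [Fintype.sum_prod_type, Finset.mul_sum]
    refine Finset.sum_congr rfl fun u _ => ?_
    rw [← inner]
    refine Finset.sum_congr rfl fun v _ => ?_
    rw [show u • l = ((u, 1) : U n F × U n F) • l from rfl, smul_smul]
    simp
  rw [← twoSidedOrbit_eq, h3, Fintype.card_prod] at h2
  rw [← finsum_set_coe_eq_finsum_mem (s := MulAction.orbit (U n F) l),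
    finsum_eq_sum_of_fintype] at h1
  rw [div_mul_eq_mul_div, div_eq_iff hO]
  push_cast at h2
  have h4 : (Fintype.card (U n F) : ℂ) * Fintype.card (U n F) ≠ 0 := mul_ne_zero hU hU
  apply mul_left_cancel₀ h4
  linear_combination (-((MulAction.orbit (U n F) l).ncard : ℂ)) * h2 +
    ((twoSidedOrbit l).ncard : ℂ) * (Fintype.card (U n F) : ℂ) * h1

/-- The monomial representation of `U` on functions on the left orbit of `l`. -/
def orbitRep (θ : AddChar F ℂ) (l : Dual F (strictUpper n F)) :
    Representation ℂ (U n F) (MulAction.orbit (U n F) l → ℂ) where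
  toFun g :=
    { toFun f m := θ (m.1 (subOne g)) * f (g⁻¹ • m)
      map_add' f f' := funext fun m => by simp [mul_add]
      map_smul' c f := funext fun m => by simp [mul_left_comm] }
  map_one' := LinearMap.ext fun f => funext fun m => by
    have : subOne (1 : U n F) = 0 := Subtype.ext (by simp)
    simp [this]
  map_mul' g h := LinearMap.ext fun f => funext fun m => by
    simp [subOne_mul, mul_smul, AddChar.map_add_eq_mul, smul_apply]
    ring

/-- In the basis of delta functions `g` acts by a monomial matrix, so only fixed points contribute
to the trace. -/
theorem character_orbitRep [Finite F] (θ : AddChar F ℂ) (l : Dual F (strictUpper n F))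
    (g : U n F) [Fintype (MulAction.orbit (U n F) l)]
    [DecidableEq (Dual F (strictUpper n F))] :
    (orbitRep θ l).character g = ∑ m : MulAction.orbit (U n F) l,
      if g⁻¹ • m.1 = m.1 then θ (m.1 (subOne g)) else 0 := by
  rw [Representation.character, LinearMap.trace_eq_matrix_trace ℂ (Pi.basisFun ℂ _), Matrix.trace]
  refine Finset.sum_congr rfl fun m _ => ?_
  rw [Matrix.diag_apply, LinearMap.toMatrix_apply, Pi.basisFun_apply, Pi.basisFun_repr]
  change θ (m.1 (subOne g)) * (Pi.single m (1 : ℂ) : _ → ℂ) (g⁻¹ • m) = _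
  rw [Pi.single_apply, mul_ite, mul_one, mul_zero]
  simp only [Subtype.ext_iff, MulAction.orbit.coe_smul]

/-- The norm of a character is the dimension of the endomorphism algebra, so irreducibility becomes
an equality of orbit sizes. -/
theorem isIrreducibleCharacter_superChar_iff [Finite F] {θ : AddChar F ℂ} (hθ : θ ≠ 1)
    (η : PosRoot n → F) :
    IsIrreducibleCharacter (superChar θ η) ↔
      ∀ X Y : strictUpper n F, form (functional η) X = (form (functional η)).flip Y →
        form (functional η) X = 0 := by
  classical
  have : Fintype (U n F) := Fintype.ofFinite _
  have : Fintype (MulAction.orbit (U n F) (functional η)) := Fintype.ofFinite _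
  have hU : (Nat.card (U n F) : ℂ) ≠ 0 := Nat.cast_ne_zero.mpr Nat.card_pos.ne'
  have : Invertible (Nat.card (U n F) : ℂ) := invertibleOfNonzero hU
  have : NeZero (Nat.card (U n F) : ℂ) := ⟨hU⟩
  have hO : ((twoSidedOrbit (functional η)).ncard : ℂ) ≠ 0 := Nat.cast_ne_zero.mpr <|
    Set.ncard_ne_zero_of_mem (a := functional η) ⟨1, 1, LinearMap.ext fun X => by simp⟩
  rw [← ncard_twoSidedOrbit_eq_iff, ← ncard_rightOrbit, ← sq]
  have hnorm : ∀ {V : Type u} [AddCommGroup V] [Module ℂ V] [FiniteDimensional ℂ V]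
      (ρ : Representation ℂ (U n F) V), (∀ g, superChar θ η g = ρ.character g) →
      (finrank ℂ (Representation.IntertwiningMap ρ ρ) = 1 ↔
        (twoSidedOrbit (functional η)).ncard = (rightOrbit (functional η)).ncard ^ 2) := by
    intro V _ _ _ ρ hρ
    have h := sum_superChar_mul_superChar_inv hθ η
    simp only [hρ] at h
    rw [ρ.card_inv_mul_sum_char_mul_char_eq_finrank ρ] at h
    rw [← Nat.cast_inj (R := ℂ), h, Nat.cast_one, div_eq_one_iff_eq hO, ← Nat.cast_pow,
      Nat.cast_inj, eq_comm]
  constructor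
  · rintro ⟨V, _, _, _, ρ, hirr, hρ⟩
    -- Schur's lemma over `ℂ`.
    exact (hnorm ρ hρ).mp (by simp)
  · intro h
    have hρ : ∀ g, superChar θ η g = (orbitRep θ (functional η)).character g := fun g => by
      rw [superChar_eq_sum_orbit hθ, character_orbitRep]
    exact ⟨_, _, _, inferInstance, orbitRep θ (functional η),
      Representation.isIrreducible_of_finrank_intertwiningMap _ ((hnorm _ hρ).mpr h), hρ⟩

/-! ### Matrix units and the support of `η` -/

/-- The matrix unit `E_{ij}` of `𝔫`, for `i < j`. -/
def unit {i j : Fin n} (hij : i < j) : strictUpper n F :=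
  ⟨Matrix.single i j 1, fun a b hba => by
    rw [Matrix.single_apply_of_ne]
    rintro ⟨rfl, rfl⟩
    exact absurd hij hba.not_gt⟩

@[simp]
theorem coe_unit {i j : Fin n} (hij : i < j) :
    (unit hij : strictUpper n F).1 = Matrix.single i j 1 := rfl

theorem functional_apply (η : PosRoot n → F) (X : strictUpper n F) :
    functional η X = ∑ p : PosRoot n, η p * X.1 p.1.1 p.1.2 := rfl

theorem ext_on_units {l m : Dual F (strictUpper n F)}
    (h : ∀ (i j : Fin n) (hij : i < j), l (unit hij) = m (unit hij)) : l = m := by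
  refine LinearMap.ext fun X => ?_
  have hX : X = ∑ p : PosRoot n, X.1 p.1.1 p.1.2 • (unit p.2 : strictUpper n F) := by
    refine Subtype.ext (Matrix.ext fun i j => ?_)
    rw [AddSubmonoidClass.coe_finsetSum, Matrix.sum_apply]
    by_cases hij : i < j
    · rw [Finset.sum_eq_single ⟨(i, j), hij⟩]
      · simp
      · rintro ⟨⟨a, b⟩, hab⟩ - hne
        have : ¬ (a = i ∧ b = j) := by rintro ⟨rfl, rfl⟩; exact hne rfl
        simp [Matrix.single_apply_of_ne _ _ _ _ _ this]
      · simp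
    · rw [X.2 i j (not_lt.mp hij), Finset.sum_eq_zero]
      rintro ⟨⟨a, b⟩, hab⟩ -
      have : ¬ (a = i ∧ b = j) := by rintro ⟨rfl, rfl⟩; exact hij hab
      simp [Matrix.single_apply_of_ne _ _ _ _ _ this]
  rw [hX, map_sum, map_sum]
  exact Finset.sum_congr rfl fun p _ => by rw [map_smul, map_smul, h]

/-- Multiplying by a matrix unit on the right and pairing with `λ_η` picks out column `b` of `η`. -/
theorem exists_of_functional_mul_unit_ne_zero {η : PosRoot n → F} {X : strictUpper n F}
    {a b : Fin n} {hab : a < b} (h : functional η (mulUpper X (unit hab)) ≠ 0) :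
    ∃ (i : Fin n) (hia : i < a), η ⟨(i, b), hia.trans hab⟩ ≠ 0 := by
  rw [functional_apply] at h
  obtain ⟨⟨⟨i, k⟩, hik⟩, -, h⟩ := Finset.exists_ne_zero_of_sum_ne_zero h
  have h1 := left_ne_zero_of_mul h
  have h2 := right_ne_zero_of_mul h
  simp only [coe_mulUpper, coe_unit] at h2
  obtain rfl : k = b := by
    by_contra hk
    exact h2 (Matrix.mul_single_apply_of_ne _ _ _ _ _ hk _)
  rw [Matrix.mul_single_apply_same, mul_one] at h2
  exact ⟨i, lt_of_not_ge fun hai => h2 (X.2 i a hai), h1⟩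

theorem exists_of_functional_unit_mul_ne_zero {η : PosRoot n → F} {X : strictUpper n F}
    {a b : Fin n} {hab : a < b} (h : functional η (mulUpper (unit hab) X) ≠ 0) :
    ∃ (k : Fin n) (hbk : b < k), η ⟨(a, k), hab.trans hbk⟩ ≠ 0 := by
  rw [functional_apply] at h
  obtain ⟨⟨⟨i, k⟩, hik⟩, -, h⟩ := Finset.exists_ne_zero_of_sum_ne_zero h
  have h1 := left_ne_zero_of_mul h
  have h2 := right_ne_zero_of_mul h
  simp only [coe_mulUpper, coe_unit] at h2
  obtain rfl : i = a := by
    by_contra hk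
    exact h2 (Matrix.single_mul_apply_of_ne _ _ _ _ _ hk _)
  rw [Matrix.single_mul_apply_same, one_mul] at h2
  exact ⟨k, lt_of_not_ge fun hkb => h2 (X.2 b k hkb), h1⟩

/-- `E_{ij} X` lives in row `i`, where `η` has its only nonzero entry in column `k`. -/
theorem functional_unit_mul {η : PosRoot n → F} (hη : IsMonomial η) {i j k : Fin n} (hij : i < j)
    (hik : i < k) (h : η ⟨(i, k), hik⟩ ≠ 0) (X : strictUpper n F) :
    functional η (mulUpper (unit hij) X) = η ⟨(i, k), hik⟩ * X.1 j k := by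
  rw [functional_apply, Finset.sum_eq_single ⟨(i, k), hik⟩]
  · simp
  · rintro ⟨⟨a, b⟩, hab⟩ - hne
    by_cases ha : a = i
    · subst ha
      rw [(hη a k hik h).1 b hab (by rintro rfl; exact hne rfl), zero_mul]
    · simp [Matrix.single_mul_apply_of_ne _ _ _ _ _ ha]
  · simp

theorem functional_mul_unit {η : PosRoot n → F} (hη : IsMonomial η) {j k l : Fin n} (hkl : k < l)
    (hjl : j < l) (h : η ⟨(j, l), hjl⟩ ≠ 0) (X : strictUpper n F) :
    functional η (mulUpper X (unit hkl)) = η ⟨(j, l), hjl⟩ * X.1 j k := by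
  rw [functional_apply, Finset.sum_eq_single ⟨(j, l), hjl⟩]
  · simp
  · rintro ⟨⟨a, b⟩, hab⟩ - hne
    by_cases hb : b = l
    · subst hb
      rw [(hη j b hjl h).2 a hab (by rintro rfl; exact hne rfl), zero_mul]
    · simp [Matrix.mul_single_apply_of_ne _ _ _ _ _ hb]
  · simp

end UnitriangularSupercharacter

end

/-! ### The crossing criterion -/

theorem mainTheorem5 {F : Type*} [Field F] [Finite F] (n : ℕ)
    (θ : AddChar F ℂ) (hθ : θ ≠ 1) (η : UnitriangularSupercharacter.PosRoot n → F) (hη : UnitriangularSupercharacter.IsMonomial η) :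
    UnitriangularSupercharacter.IsIrreducibleCharacter
        (UnitriangularSupercharacter.superChar θ η) ↔
      ¬ ∃ (i j k l : Fin n) (hij : i < j) (hjk : j < k) (hkl : k < l),
        (⟨(i, k), hij.trans hjk⟩ : UnitriangularSupercharacter.PosRoot n) ∈ Function.support η ∧
        (⟨(j, l), hjk.trans hkl⟩ : UnitriangularSupercharacter.PosRoot n) ∈ Function.support η := by
  open UnitriangularSupercharacter in
  rw [isIrreducibleCharacter_superChar_iff hθ]
  constructor
  · rintro H ⟨i, j, k, l, hij, hjk, hkl, h1, h2⟩
    have h1' := Function.mem_support.mp h1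
    have h2' := Function.mem_support.mp h2
    -- The inverse scalars normalize both functionals to the same coordinate `X ↦ X_{jk}`, whose
    -- value at `E_{jk}` is `1`.
    have h := H ((η ⟨(i, k), hij.trans hjk⟩)⁻¹ • unit hij)
      ((η ⟨(j, l), hjk.trans hkl⟩)⁻¹ • unit hkl) (LinearMap.ext fun X => by
        rw [LinearMap.flip_apply, map_smul, map_smul, LinearMap.smul_apply, form_apply, form_apply,
          functional_unit_mul hη hij _ h1', functional_mul_unit hη hkl _ h2', smul_eq_mul,
          smul_eq_mul, inv_mul_cancel_left₀ h1', inv_mul_cancel_left₀ h2'])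
    have h := LinearMap.congr_fun h (unit hjk)
    rw [map_smul, LinearMap.smul_apply, form_apply, functional_unit_mul hη hij _ h1', smul_eq_mul,
      inv_mul_cancel_left₀ h1'] at h
    simp at h
  · intro H X Y hXY
    refine ext_on_units fun j k hjk => ?_
    by_contra hne
    -- The same nonzero value is `λ(X E_{jk})` and `λ(E_{jk} Y)`: the first yields an entry in
    -- column `k` above row `j`, the second one in row `j` right of column `k`.
    have h2 : form (functional η) X (unit hjk) ≠ 0 := hne
    have h1 := h2
    rw [hXY] at h1
    obtain ⟨i, hij, hi⟩ := exists_of_functional_mul_unit_ne_zero h2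
    obtain ⟨l, hkl, hl⟩ := exists_of_functional_unit_mul_ne_zero h1
    exact H ⟨i, j, k, l, hij, hjk, hkl, hi, hl⟩
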